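/- Let $d\ge 2$ and $L=(d-1)(d+2)/2$. Let $\lambda_1,\dots,\lambda_L$ be the real (symmetric and diagonal) generalized Gell-Mann matrices of size $d$, i.e. $\sqrt{d/2}\,(|j\rangle\langle k|+|k\rangle\langle j|)$ for $0\le j<k\le d-1$ and $\sqrt{\tfrac{d}{(l+1)(l+2)}}\big(\sum_{j=0}^{l}|j\rangle\langle j|-(l+1)|l+1\rangle\langle l+1|\big)$ for $0\le l\le d-2$. For a state $\varrho$ (density matrix) on $\mathbb C^d\otimes\mathbb C^d$ let $T_R=(T_{jk})_{j,k=1}^{L}$, $T_{jk}=\mathrm{tr}(\varrho\,\lambda_j\otimes\lambda_k)$, be the real-real block of its correlation matrix, and let $\tau_1,\dots,\tau_L$ be the singular values of $T_R$. For $\tau\in\mathbb R^L$ put $$Q^{(2)}(\tau)=\frac1{L^2}\sum_{j=1}^L\tau_j^2,\qquad Q^{(4)}(\tau)=W\Big[2\sum_{j=1}^L\tau_j^4+L^4\big(Q^{(2)}(\tau)\big)^2\Big],\qquad W=\frac{3\,\Gamma(L/2)^2}{16\,\Gamma((L+4)/2)^2}.$$ The second and fourth moments of real randomized measurements (RRMs)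 on $\varrho$ are the values $C_2=Q^{(2)}(\tau)$ and $C_4=Q^{(4)}(\tau)$ at the singular values $\tau$ of $T_R$. The Schmidt number $\mathrm{SN}(\varrho)$ is the least $r$ such that $\varrho$ is a convex combination of pure states of Schmidt rank at most $r$. For $x\in\{1,\dots,d\}$ and $y\ge0$ consider the problem of minimizing $Q^{(4)}(\tau)$ over all $\tau\in\mathbb R^L$ with $$Q^{(2)}(\tau)=y,\qquad \sum_{j=1}^L\tau_j\le xd-1,\qquad \tau_j\in[0,d-1]\ (1\le j\le L).\tag{P$_{x,y}$}$$ For $0\le y<(dx-1)^2/L^2$ define $$F_{\min}(x,y)=\begin{cases}WL^3y^2(2+L), & 0\le y\le \frac{(dx-1)^2}{L^3},\\[2pt] \dfrac{2Wf(n,y)}{(n+1)^4}+WL^4y^2, & \frac{(dx-1)^2}{L^2(n+1)}\le y<\frac{(dx-1)^2}{L^2n},\quad n=1,\dots,L-1,\end{cases}$$ where $f(n,y)=[\mathcal B-(dx-1)]^4+[\mathcal B+n(dx-1)]^4/n^3$ and $\mathcal B=\sqrt{n(n+1)L^2y-n(dx-1)^2}$. (1) If $1\le x\le d$, $0\le y<(dx-1)^2/L^2$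 and the constraints of (P$_{x,y}$) can be satisfied, then $F_{\min}(x,y)$ is the minimum of (P$_{x,y}$), and it is attained. (2) Let $\varrho$ be a state on $\mathbb C^d\otimes\mathbb C^d$ with moments $C_2,C_4$, and let $2\le r\le d$. If $C_2<(d(r-1)-1)^2/L^2$ and $C_4<F_{\min}(r-1,C_2)$, then $\mathrm{SN}(\varrho)\ge r$; in particular $\mathrm{SN}(\varrho)=d$ if $r=d$. The same conclusions hold, without the condition on $C_2$, if $C_4$ is smaller than $Q^{(4)}(\tau)$ for every $\tau$ that satisfies the constraints of (P$_{r-1,C_2}$) (in particular if no such $\tau$ exists). -/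

import Mathlib

open scoped Kronecker ComplexOrder

noncomputable section

namespace RRM

/-- `L = (d-1)(d+2)/2`, the number of real generalized Gell-Mann matrices (the division is exact). -/
def numReal (d : ℕ) : ℕ := (d - 1) * (d + 2) / 2

/-- Labels of the real generalized Gell-Mann matrices: a pair `j < k` for a symmetric one,
a number `0 ≤ l ≤ d - 2` for a diagonal one. -/
abbrev RealIdx (d : ℕ) : Type := {p : Fin d × Fin d // p.1 < p.2} ⊕ Fin (d - 1)

/-- The real generalized Gell-Mann matrices, normalized by `tr (λ_a λ_b) = d δ_ab`:
`√(d/2) (|j⟩⟨k| + |k⟩⟨j|)` for `j < k`, and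
`√(d/((l+1)(l+2))) (∑_{j ≤ l} |j⟩⟨j| - (l+1) |l+1⟩⟨l+1|)`. -/
def realGGM (d : ℕ) : RealIdx d → Matrix (Fin d) (Fin d) ℂ
  | Sum.inl p =>
      ((Real.sqrt ((d : ℝ) / 2) : ℝ) : ℂ) •
        (Matrix.single p.1.1 p.1.2 (1 : ℂ) + Matrix.single p.1.2 p.1.1 (1 : ℂ))
  | Sum.inr l =>
      ((Real.sqrt ((d : ℝ) / (((l : ℝ) + 1) * ((l : ℝ) + 2))) : ℝ) : ℂ) •
        Matrix.diagonal (fun j : Fin d =>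
          if (j : ℕ) ≤ (l : ℕ) then (1 : ℂ)
          else if (j : ℕ) = (l : ℕ) + 1 then -((l : ℂ) + 1) else 0)

/-- Operators on `ℂ^d ⊗ ℂ^d` in the product basis. -/
abbrev BipartiteOp (d : ℕ) : Type := Matrix (Fin d × Fin d) (Fin d × Fin d) ℂ

/-- Two-qudit states: density matrices on `ℂ^d ⊗ ℂ^d`. -/
def IsState {d : ℕ} (ρ : BipartiteOp d) : Prop := ρ.PosSemidef ∧ ρ.trace = 1

/-- The real-real block `T_R` of the correlation matrix. Its entries `T_ab = tr (ρ (λ_a ⊗ λ_b))` are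
the coefficients of `ρ = d⁻² ∑ T_ab λ_a ⊗ λ_b`, by `tr (λ_a λ_b) = d δ_ab`; the trace is real for a
Hermitian `ρ`. -/
def corrReal {d : ℕ} (ρ : BipartiteOp d) : Matrix (RealIdx d) (RealIdx d) ℝ :=
  Matrix.of fun a b => (ρ * (realGGM d a ⊗ₖ realGGM d b)).trace.re

/-- The singular values `τ_1 ≥ … ≥ τ_L` of `T_R`. -/
def tau {d : ℕ} (ρ : BipartiteOp d) : Fin (numReal d) → ℝ :=
  fun j => (Matrix.toEuclideanLin (corrReal ρ)).singularValues (j : ℕ)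

/-- The normalization `W = 3 Γ(L/2)² / (16 Γ((L+4)/2)²)`. -/
def W (d : ℕ) : ℝ :=
  3 * Real.Gamma ((numReal d : ℝ) / 2) ^ 2 / (16 * Real.Gamma (((numReal d : ℝ) + 4) / 2) ^ 2)

/-- The second moment as a function of the singular values. -/
def Q2 (d : ℕ) (τ : Fin (numReal d) → ℝ) : ℝ := 1 / (numReal d : ℝ) ^ 2 * ∑ j, τ j ^ 2

/-- The fourth moment as a function of the singular values. -/
def Q4 (d : ℕ) (τ : Fin (numReal d) → ℝ) : ℝ :=
  W d * (2 * ∑ j, τ j ^ 4 + (numReal d : ℝ) ^ 4 * Q2 d τ ^ 2)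

/-- The constraints of the optimization problem at level `r` with prescribed second moment `C₂`. -/
def feasible (d r : ℕ) (C₂ : ℝ) : Set (Fin (numReal d) → ℝ) :=
  {τ | Q2 d τ = C₂ ∧ ∑ j, τ j ≤ (r : ℝ) * d - 1 ∧ ∀ j, τ j ∈ Set.Icc (0 : ℝ) ((d : ℝ) - 1)}

/-- The quantity `𝓑 = √(n(n+1)L²y - n(dx-1)²)`. -/
def calB (d n x : ℕ) (y : ℝ) : ℝ :=
  Real.sqrt ((n : ℝ) * ((n : ℝ) + 1) * (numReal d : ℝ) ^ 2 * y - (n : ℝ) * ((d : ℝ) * x - 1) ^ 2)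

/-- `f(n,y) = (𝓑 - (dx-1))⁴ + (𝓑 + n(dx-1))⁴ / n³`. -/
def fAux (d n x : ℕ) (y : ℝ) : ℝ :=
  (calB d n x y - ((d : ℝ) * x - 1)) ^ 4
    + (calB d n x y + (n : ℝ) * ((d : ℝ) * x - 1)) ^ 4 / (n : ℝ) ^ 3

/-- The branch `F_min^{(n)}(x,y) = 2 W f(n,y) / (n+1)⁴ + W L⁴ y²`. -/
def FminBranch (d n x : ℕ) (y : ℝ) : ℝ :=
  2 * W d * fAux d n x y / ((n : ℝ) + 1) ^ 4 + W d * (numReal d : ℝ) ^ 4 * y ^ 2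

/-- `n` is the branch index `n_g` that belongs to `(x, y)`. For given `(x, y)` there is at most one
such `n`, as the intervals for different `n` are disjoint. -/
def IsBranch (d n x : ℕ) (y : ℝ) : Prop :=
  1 ≤ n ∧ n ≤ numReal d - 1 ∧
    ((d : ℝ) * x - 1) ^ 2 / ((numReal d : ℝ) ^ 2 * ((n : ℝ) + 1)) ≤ y ∧
    y < ((d : ℝ) * x - 1) ^ 2 / ((numReal d : ℝ) ^ 2 * (n : ℝ))

open Classical in
/-- The explicit function `F_min(x,y)`, defined piecewise for `0 ≤ y < (dx-1)²/L²`
(and set to `0` for other `y`, where it is never used). -/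
def Fmin (d x : ℕ) (y : ℝ) : ℝ :=
  if 0 ≤ y ∧ y ≤ ((d : ℝ) * x - 1) ^ 2 / (numReal d : ℝ) ^ 3 then
    W d * (numReal d : ℝ) ^ 3 * y ^ 2 * (2 + (numReal d : ℝ))
  else if h : ∃ n, IsBranch d n x y then FminBranch d h.choose x y
  else 0

/-- The Schmidt rank of a vector of `ℂ^d ⊗ ℂ^d`: the rank of its coefficient matrix. -/
def schmidtRank {d : ℕ} (ψ : Fin d × Fin d → ℂ) : ℕ :=
  (Matrix.of fun i j => ψ (i, j)).rank

/-- `ρ` is a finite convex combination of pure states of Schmidt rank at most `r`. -/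
def HasSchmidtDecomposition {d : ℕ} (ρ : BipartiteOp d) (r : ℕ) : Prop :=
  ∃ (N : ℕ) (p : Fin N → ℝ) (ψ : Fin N → Fin d × Fin d → ℂ),
    (∀ j, 0 ≤ p j) ∧ ∑ j, p j = 1 ∧
    (∀ j, ∑ i, ‖ψ j i‖ ^ 2 = 1) ∧ (∀ j, schmidtRank (ψ j) ≤ r) ∧
    ρ = ∑ j, ((p j : ℝ) : ℂ) • Matrix.vecMulVec (ψ j) (star (ψ j))

/-- The Schmidt number `SN(ρ)`. -/
def schmidtNumber {d : ℕ} (ρ : BipartiteOp d) : ℕ := sInf {r | HasSchmidtDecomposition ρ r}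

end RRM

end

noncomputable section

namespace RRM

/-! The two claims meet in the constraint set: the singular values of a state of Schmidt number at
most `x` lie in it (`tau_mem_feasible`), so a fourth moment below the minimum for `x = r - 1` rules
out Schmidt number at most `r - 1`.

Minimum: put s = dx - 1. For small y the constant vector is feasible and Cauchy-Schwarz suffices.
Otherwise the minimizer is (a, …, a, b, 0, …, 0), with n entries a ≥ b ≥ 0, sum s and the prescribed
sum of squares. Since t⁴ is the integral of 12u·max(t - u, 0)² over u ≥ 0, it is enough to compare
the sums of max(τ_i - u, 0)² at each level u (`truncated_sq_le`). The same comparison at u = d - 1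
gives a ≤ d - 1 as soon as the problem is feasible, so the cap on the entries never changes the
minimizer.

Constraints: the sum of the τ_j is a sum of correlations along singular vectors, linear in the
state, so pure states suffice. For a coefficient matrix M the correlation of A and B is tr(M†AMBᵀ),
with Bᵀ = B for real Gell-Mann matrices. In an eigenbasis of M†M, Bessel's inequality for the
identity and the Gell-Mann matrices bounds 1 + ∑ τ_j by d(∑ √c_i)², c_i the squared Schmidt
coefficients. This is at most dx, as at most x of them are nonzero and they sum to 1. A single τ_j
is at most d - 1 because a traceless Hermitian matrix with squared Frobenius norm at most d has
operator norm at most √(d-1). -/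

/-! ### Extremal families for truncated squares and fourth powers -/

/-- A total excess of `r i ≤ u` over the level `b` is bounded through the number `k` of entries
above `b`. -/
theorem exists_sum_max_sub_le {ι : Type*} [Fintype ι] (r : ι → ℝ) {u b : ℝ}
    (h0 : ∀ i, 0 ≤ r i) (hu : ∀ i, r i ≤ u) :
    ∃ k : ℕ, ∑ i, max (r i - b) 0 ≤ k * (u - b) ∧ ∑ i, max (r i - b) 0 ≤ ∑ i, r i - k * b := by
  classical
  have key : ∑ i, max (r i - b) 0 = ∑ i with b < r i, (r i - b) := by
    rw [Finset.sum_filter]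
    refine Finset.sum_congr rfl fun i _ => ?_
    split_ifs with h
    · exact max_eq_left (by linarith)
    · exact max_eq_right (by linarith)
  refine ⟨(Finset.univ.filter fun i => b < r i).card, ?_, ?_⟩
  · rw [key, ← nsmul_eq_mul]
    exact Finset.sum_le_card_nsmul _ _ _ fun i _ => by linarith [hu i]
  · rw [key, Finset.sum_sub_distrib, Finset.sum_const, nsmul_eq_mul]
    have := Finset.sum_le_univ_sum_of_nonneg (s := Finset.univ.filter fun i => b < r i) h0
    linarith

/-- For 0 ≤ b ≤ u the right side is the piecewise linear interpolant of the convex function t² at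
the nodes 0, b, u. -/
theorem sq_le_chord {t u b : ℝ} (ht : 0 ≤ t) (hu : t ≤ u) :
    t ^ 2 ≤ b * t + u * max (t - b) 0 := by
  rcases le_total t b with h | h
  · rw [max_eq_right (by linarith)]
    nlinarith
  · rw [max_eq_left (by linarith)]
    nlinarith

theorem sum_sq_le_chord {ι : Type*} [Fintype ι] (r : ι → ℝ) {u b : ℝ}
    (h0 : ∀ i, 0 ≤ r i) (hu : ∀ i, r i ≤ u) :
    ∑ i, r i ^ 2 ≤ b * ∑ i, r i + u * ∑ i, max (r i - b) 0 := by
  rw [Finset.mul_sum, Finset.mul_sum, ← Finset.sum_add_distrib]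
  exact Finset.sum_le_sum fun i _ => sq_le_chord (h0 i) (hu i)

/-- Filling up to the level `u` maximizes the sum of squares. -/
theorem sum_sq_le_of_sum_le {ι : Type*} [Fintype ι] (r : ι → ℝ) {u b : ℝ} (n : ℕ)
    (h0 : ∀ i, 0 ≤ r i) (hu : ∀ i, r i ≤ u) (hb : 0 ≤ b) (hbu : b ≤ u)
    (hR : ∑ i, r i ≤ n * u + b) : ∑ i, r i ^ 2 ≤ n * u ^ 2 + b ^ 2 := by
  obtain ⟨k, hk1, hk2⟩ := exists_sum_max_sub_le r (b := b) h0 hu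
  have h := sum_sq_le_chord r (b := b) h0 hu
  set R := ∑ i, r i
  set P := ∑ i, max (r i - b) 0
  -- The two bounds on P agree at k = n for total n u + b - b; the first serves k ≤ n, the second k
  -- ≥ n + 1.
  have hP : P ≤ n * (u - b) := by
    rcases le_or_gt k n with hkn | hkn
    · have : (k : ℝ) ≤ n := by exact_mod_cast hkn
      nlinarith
    · have : (n : ℝ) + 1 ≤ k := by exact_mod_cast hkn
      nlinarith
  nlinarith [mul_le_mul_of_nonneg_left hP (hb.trans hbu), mul_le_mul_of_nonneg_left hR hb]

/-- The function 2ut - t² is concave and increasing on [0, u], so with total at least n u + b its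
sum is smallest for the family filled up to u. -/
theorem fill_le_two_mul_sum_sub_sum_sq {ι : Type*} [Fintype ι] (r : ι → ℝ) {u b : ℝ} (n : ℕ)
    (h0 : ∀ i, 0 ≤ r i) (hu : ∀ i, r i ≤ u) (hb : 0 ≤ b) (hbu : b ≤ u)
    (hR : n * u + b ≤ ∑ i, r i) :
    n * u ^ 2 + 2 * u * b - b ^ 2 ≤ 2 * u * ∑ i, r i - ∑ i, r i ^ 2 := by
  obtain ⟨k, hk1, hk2⟩ := exists_sum_max_sub_le r (b := b) h0 hu
  have h := sum_sq_le_chord r (b := b) h0 hu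
  set R := ∑ i, r i
  set P := ∑ i, max (r i - b) 0
  have hu0 : 0 ≤ u := hb.trans hbu
  rcases le_or_gt k n with hkn | hkn
  · have : (k : ℝ) ≤ n := by exact_mod_cast hkn
    have hP : P ≤ n * (u - b) := by nlinarith
    have h1 := mul_le_mul_of_nonneg_left hP hu0
    have h2 := mul_le_mul_of_nonneg_left hR (show 0 ≤ 2 * u - b by linarith)
    nlinarith
  · have : (n : ℝ) + 1 ≤ k := by exact_mod_cast hkn
    have hP : P ≤ R - (n + 1) * b := by nlinarith
    have h1 := mul_le_mul_of_nonneg_left hP hu0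
    have h2 := mul_le_mul_of_nonneg_left hR (show 0 ≤ u - b by linarith)
    nlinarith

/-- Among nonnegative families with prescribed sum of squares `n a² + b²` and sum at most `n a + b`,
the family `(a, …, a, b, 0, …)` minimizes all truncated second moments. -/
theorem truncated_sq_le {ι : Type*} [Fintype ι] (τ : ι → ℝ) {a b u : ℝ} (n : ℕ)
    (h0 : ∀ i, 0 ≤ τ i) (hb : 0 ≤ b) (hba : b ≤ a) (hu : 0 ≤ u)
    (hq : ∑ i, τ i ^ 2 = n * a ^ 2 + b ^ 2) (hs : ∑ i, τ i ≤ n * a + b) :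
    n * max (a - u) 0 ^ 2 + max (b - u) 0 ^ 2 ≤ ∑ i, max (τ i - u) 0 ^ 2 := by
  classical
  have hΦ0 : 0 ≤ ∑ i, max (τ i - u) 0 ^ 2 := Finset.sum_nonneg fun i _ => sq_nonneg _
  rcases le_or_gt a u with hau | hau
  · rw [max_eq_right (by linarith), max_eq_right (by linarith)]
    simpa using hΦ0
  -- The extremal family is cut at level u like τ: b' and B are the parts of b below and above u,
  -- and B ≠ 0 forces b' = u.
  set b' := min b u with hb'
  set A := a - u with hA
  set B := max (b - u) 0 with hB
  have hb'0 : 0 ≤ b' := le_min hb hu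
  have hb'u : b' ≤ u := min_le_right _ _
  have hB0 : 0 ≤ B := le_max_right _ _
  have hBA : B ≤ A := max_le (by linarith) (by linarith)
  have hbB : b = b' + B := by
    rcases le_total b u with h | h
    · simp [hb', hB, h]
    · simp [hb', hB, h]
  have hBu : B * u = B * b' := by
    rcases le_total b u with h | h
    · simp [hB, h]
    · simp [hb', h]
  rw [max_eq_left (by linarith : 0 ≤ a - u), ← hA]
  have e1 : ∑ i, τ i = ∑ i, min (τ i) u + ∑ i, max (τ i - u) 0 := by
    rw [← Finset.sum_add_distrib]
    refine Finset.sum_congr rfl fun i _ => ?_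
    rcases le_total (τ i) u with h | h <;> simp [h]
  have e2 : ∑ i, τ i ^ 2 = ∑ i, min (τ i) u ^ 2 + 2 * u * ∑ i, max (τ i - u) 0
      + ∑ i, max (τ i - u) 0 ^ 2 := by
    rw [Finset.mul_sum, ← Finset.sum_add_distrib, ← Finset.sum_add_distrib]
    refine Finset.sum_congr rfl fun i _ => ?_
    rcases le_total (τ i) u with h | h
    · simp [h]
    · simp only [h, min_eq_right, sub_nonneg, sup_of_le_left]; ring
  have hr0 : ∀ i, 0 ≤ min (τ i) u := fun i => le_min (h0 i) hu
  have hru : ∀ i, min (τ i) u ≤ u := fun i => min_le_right _ _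
  have hfilter : ∑ i, max (τ i - u) 0 = ∑ i with u < τ i, max (τ i - u) 0 := by
    rw [Finset.sum_filter]
    refine Finset.sum_congr rfl fun i _ => ?_
    split_ifs with h
    · rfl
    · exact max_eq_right (by linarith)
  have hP2 : (∑ i, max (τ i - u) 0) ^ 2
      ≤ (Finset.univ.filter fun i => u < τ i).card * ∑ i, max (τ i - u) 0 ^ 2 := by
    rw [hfilter]
    refine sq_sum_le_card_mul_sum_sq.trans ?_
    refine mul_le_mul_of_nonneg_left ?_ (Nat.cast_nonneg _)
    exact Finset.sum_le_univ_sum_of_nonneg fun i => sq_nonneg _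
  have hkR : ((Finset.univ.filter fun i => u < τ i).card : ℝ) * u ≤ ∑ i, min (τ i) u := by
    rw [← nsmul_eq_mul]
    refine (Finset.card_nsmul_le_sum _ (fun i => min (τ i) u) u fun i hi => ?_).trans
      (Finset.sum_le_univ_sum_of_nonneg hr0)
    exact le_min (Finset.mem_filter.1 hi).2.le le_rfl
  have hP0 : 0 ≤ ∑ i, max (τ i - u) 0 := Finset.sum_nonneg fun i _ => le_max_right _ _
  set Φ := ∑ i, max (τ i - u) 0 ^ 2
  set P := ∑ i, max (τ i - u) 0
  set k := (Finset.univ.filter fun i => u < τ i).card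
  have haA : a = A + u := by ring
  -- The case split compares the mass of τ below level u with that of the extremal family, n u + b'.
  -- If it is larger, the constraint on the total sum bounds P from above and the claim is linear.
  rcases le_or_gt (n * u + b') (∑ i, min (τ i) u) with hR | hR
  · have h := fill_le_two_mul_sum_sub_sum_sq _ n hr0 hru hb'0 hb'u hR
    set R := ∑ i, min (τ i) u
    have h2 := mul_le_mul_of_nonneg_left hs (show 0 ≤ 2 * u by linarith)
    rw [e1] at h2
    rw [hbB] at h2 hq
    rw [haA] at h2 hq
    nlinarith
  · have h := sum_sq_le_of_sum_le _ n hr0 hru hb'0 hb'u hR.le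
    -- More than n entries above u would carry mass at least (n + 1)u ≥ n u + b' below level u.
    have hkn : k ≤ n := by
      by_contra hc
      have : (n : ℝ) + 1 ≤ k := by exact_mod_cast not_le.1 hc
      nlinarith
    have hkn' : (k : ℝ) ≤ n := by exact_mod_cast hkn
    have h3 : n * A ^ 2 + B ^ 2 + 2 * u * (n * A + B) ≤ Φ + 2 * u * P := by
      rw [hbB, haA] at hq
      nlinarith
    -- If Φ were too small, Cauchy-Schwarz over the k ≤ n entries above u would give P ≤ nA + B,
    -- contradicting `h3`.
    by_contra hc
    push Not at hc
    have hn : (0 : ℝ) ≤ n := Nat.cast_nonneg n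
    have hA0 : 0 ≤ A := hB0.trans hBA
    have h4 : P ^ 2 ≤ (n * A + B) ^ 2 := by
      have h5 : P ^ 2 ≤ n * (n * A ^ 2 + B ^ 2) :=
        hP2.trans ((mul_le_mul_of_nonneg_right hkn' hΦ0).trans
          (mul_le_mul_of_nonneg_left hc.le hn))
      have h6 : (n : ℝ) * B * B ≤ n * B * A := mul_le_mul_of_nonneg_left hBA (by positivity)
      have h7 : (0 : ℝ) ≤ n * B * A := by positivity
      nlinarith
    have h8 : P ≤ n * A + B := (sq_le_sq₀ hP0 (by positivity)).1 h4
    nlinarith [mul_le_mul_of_nonneg_left h8 hu]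

theorem integral_mul_max_sub_sq {t M : ℝ} (ht : 0 ≤ t) (htM : t ≤ M) :
    ∫ u in (0 : ℝ)..M, 12 * u * max (t - u) 0 ^ 2 = t ^ 4 := by
  have hc : Continuous fun u : ℝ => 12 * u * max (t - u) 0 ^ 2 := by fun_prop
  rw [← intervalIntegral.integral_add_adjacent_intervals (b := t) (hc.intervalIntegrable _ _)
    (hc.intervalIntegrable _ _)]
  have h1 : ∫ u in (0 : ℝ)..t, 12 * u * max (t - u) 0 ^ 2
      = ∫ u in (0 : ℝ)..t, 12 * u * (t - u) ^ 2 := by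
    refine intervalIntegral.integral_congr fun u hu => ?_
    rw [Set.uIcc_of_le ht] at hu
    simp only [max_eq_left (sub_nonneg.2 hu.2)]
  have h2 : ∫ u in t..M, 12 * u * max (t - u) 0 ^ 2 = ∫ u in t..M, (0 : ℝ) := by
    refine intervalIntegral.integral_congr fun u hu => ?_
    rw [Set.uIcc_of_le htM] at hu
    simp only [max_eq_right (sub_nonpos.2 hu.1)]
    ring
  have h3 : ∫ u in (0 : ℝ)..t, 12 * u * (t - u) ^ 2 = t ^ 4 := by
    rw [intervalIntegral.integral_eq_sub_of_hasDerivAt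
      (f := fun u => 6 * t ^ 2 * u ^ 2 - 8 * t * u ^ 3 + 3 * u ^ 4)]
    · ring
    · intro u _
      have := ((((hasDerivAt_id u).pow 2).const_mul (6 * t ^ 2)).sub
        (((hasDerivAt_id u).pow 3).const_mul (8 * t))).add (((hasDerivAt_id u).pow 4).const_mul 3)
      convert! this using 1
      simp
      ring
    · exact (by fun_prop : Continuous fun u : ℝ => 12 * u * (t - u) ^ 2).intervalIntegrable _ _
  rw [h1, h2, h3]
  simp

/-- The fourth-power sum is minimized by `(a, …, a, b, 0, …)`. -/
theorem sum_pow_four_ge {ι : Type*} [Fintype ι] (τ : ι → ℝ) {a b : ℝ} (n : ℕ)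
    (h0 : ∀ i, 0 ≤ τ i) (hb : 0 ≤ b) (hba : b ≤ a)
    (hq : ∑ i, τ i ^ 2 = n * a ^ 2 + b ^ 2) (hs : ∑ i, τ i ≤ n * a + b) :
    n * a ^ 4 + b ^ 4 ≤ ∑ i, τ i ^ 4 := by
  set M := a + ∑ i, τ i
  have ha : 0 ≤ a := hb.trans hba
  have hS : 0 ≤ ∑ i, τ i := Finset.sum_nonneg fun i _ => h0 i
  have hτM : ∀ i, τ i ≤ M := fun i =>
    (Finset.single_le_sum (fun j _ => h0 j) (Finset.mem_univ i)).trans (by simp [M, ha])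
  have hc : ∀ t : ℝ, Continuous fun u : ℝ => 12 * u * max (t - u) 0 ^ 2 := fun t => by fun_prop
  have haM : a ≤ M := by simp [M, hS]
  rw [← integral_mul_max_sub_sq ha haM, ← integral_mul_max_sub_sq hb (hba.trans haM),
    ← intervalIntegral.integral_const_mul, ← intervalIntegral.integral_add
      (((hc a).const_mul _).intervalIntegrable _ _) ((hc b).intervalIntegrable _ _),
    Finset.sum_congr rfl fun i _ => (integral_mul_max_sub_sq (h0 i) (hτM i)).symm,
    ← intervalIntegral.integral_finsetSum fun i _ => (hc (τ i)).intervalIntegrable _ _]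
  refine intervalIntegral.integral_mono_on (ha.trans haM) ?_ ?_ fun u hu => ?_
  · exact (((hc a).const_mul _).add (hc b)).intervalIntegrable _ _
  · exact (continuous_finsetSum _ fun i _ => hc (τ i)).intervalIntegrable _ _
  · have h := truncated_sq_le τ n h0 hb hba hu.1 hq hs
    rw [← Finset.mul_sum]
    have := mul_le_mul_of_nonneg_left h (by linarith [hu.1] : 0 ≤ 12 * u)
    linarith

/-- The largest entry `a` of the extremal family is at most the maximum of every competitor. -/
theorem stepHeight_le {ι : Type*} [Fintype ι] (τ : ι → ℝ) {a b M : ℝ} {n : ℕ} (hn : 1 ≤ n)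
    (h0 : ∀ i, 0 ≤ τ i) (hb : 0 ≤ b) (hba : b ≤ a) (hM : 0 ≤ M) (hτ : ∀ i, τ i ≤ M)
    (hq : ∑ i, τ i ^ 2 = n * a ^ 2 + b ^ 2) (hs : ∑ i, τ i ≤ n * a + b) : a ≤ M := by
  have h := truncated_sq_le τ n h0 hb hba hM hq hs
  rw [Finset.sum_eq_zero fun i _ => by rw [max_eq_right (by linarith [hτ i])]; simp] at h
  by_contra hc
  push Not at hc
  rw [max_eq_left (by linarith)] at h
  have h1 : (1 : ℝ) ≤ n := by exact_mod_cast hn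
  nlinarith [sq_nonneg (max (b - M) 0), mul_pos (sub_pos.2 hc) (sub_pos.2 hc)]

/-! ### Solution of the optimization problem -/

theorem two_le_numReal {d : ℕ} (hd : 2 ≤ d) : 2 ≤ numReal d := by
  unfold numReal
  obtain ⟨e, rfl⟩ := Nat.exists_eq_add_of_le hd
  rw [Nat.le_div_iff_mul_le two_pos]
  have : 2 + e - 1 = e + 1 := by omega
  rw [this]
  nlinarith

theorem W_pos {d : ℕ} (hd : 2 ≤ d) : 0 < W d := by
  have hL : (0 : ℝ) < numReal d := by exact_mod_cast (two_pos.trans_le (two_le_numReal hd))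
  have h1 : 0 < Real.Gamma ((numReal d : ℝ) / 2) := Real.Gamma_pos_of_pos (by positivity)
  have h2 : 0 < Real.Gamma (((numReal d : ℝ) + 4) / 2) := Real.Gamma_pos_of_pos (by positivity)
  unfold W
  positivity

/-- The vector `(a, …, a, b, 0, …, 0)` with `n` entries `a`. -/
def stepVector (L n : ℕ) (a b : ℝ) : Fin L → ℝ :=
  fun j => if (j : ℕ) < n then a else if (j : ℕ) = n then b else 0

theorem sum_stepVector {L n : ℕ} (hn : n < L) (a b : ℝ) (g : ℝ → ℝ) (hg : g 0 = 0) :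
    ∑ j, g (stepVector L n a b j) = n * g a + g b := by
  unfold stepVector
  rw [Fin.sum_univ_eq_sum_range (fun j => g (if j < n then a else if j = n then b else 0)) L,
    ← Finset.sum_subset (Finset.range_mono (Nat.succ_le_of_lt hn)), Finset.sum_range_succ,
    Finset.sum_congr rfl fun j hj => by rw [if_pos (Finset.mem_range.1 hj)]]
  · simp
  · intro j _ hj
    have : ¬ j < n + 1 := by simpa using hj
    rw [if_neg (by omega), if_neg (by omega), hg]

theorem stepVector_mem {L n : ℕ} {a b M : ℝ} (hb : 0 ≤ b) (hba : b ≤ a) (haM : a ≤ M)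
    (j : Fin L) : stepVector L n a b j ∈ Set.Icc 0 M := by
  unfold stepVector
  split_ifs <;> constructor <;> linarith

theorem Q2_eq_iff {d : ℕ} (hd : 2 ≤ d) (τ : Fin (numReal d) → ℝ) (y : ℝ) :
    Q2 d τ = y ↔ ∑ j, τ j ^ 2 = (numReal d : ℝ) ^ 2 * y := by
  have hL : (0 : ℝ) < numReal d := by exact_mod_cast (two_pos.trans_le (two_le_numReal hd))
  unfold Q2
  rw [one_div, inv_mul_eq_iff_eq_mul₀ (by positivity)]

/-- Comparison of fourth moments reduces to comparison of fourth-power sums. -/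
theorem isLeast_Q4 {d x : ℕ} {y m : ℝ} (hd : 2 ≤ d) (τ₀ : Fin (numReal d) → ℝ)
    (h₀ : τ₀ ∈ feasible d x y) (hm : m = W d * (2 * ∑ j, τ₀ j ^ 4 + (numReal d : ℝ) ^ 4 * y ^ 2))
    (hmin : ∀ τ ∈ feasible d x y, ∑ j, τ₀ j ^ 4 ≤ ∑ j, τ j ^ 4) :
    IsLeast (Q4 d '' feasible d x y) m := by
  refine ⟨⟨τ₀, h₀, ?_⟩, ?_⟩
  · rw [hm, Q4, h₀.1]
  · rintro _ ⟨τ, hτ, rfl⟩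
    rw [hm, Q4, hτ.1]
    have := hmin τ hτ
    exact mul_le_mul_of_nonneg_left (by linarith) (W_pos hd).le

theorem isLeast_of_le {d x : ℕ} {y : ℝ} (hd : 2 ≤ d) (hx : 1 ≤ x) (hy : 0 ≤ y)
    (hy' : y ≤ ((d : ℝ) * x - 1) ^ 2 / (numReal d : ℝ) ^ 3) (hne : (feasible d x y).Nonempty) :
    IsLeast (Q4 d '' feasible d x y)
      (W d * (numReal d : ℝ) ^ 3 * y ^ 2 * (2 + (numReal d : ℝ))) := by
  have hL : (0 : ℝ) < numReal d := by exact_mod_cast (two_pos.trans_le (two_le_numReal hd))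
  have hd' : (2 : ℝ) ≤ d := by exact_mod_cast hd
  have hx' : (1 : ℝ) ≤ x := by exact_mod_cast hx
  have hs : 0 ≤ (d : ℝ) * x - 1 := by nlinarith
  obtain ⟨τ, hτ⟩ := hne
  set L : ℝ := (numReal d : ℝ) with hLdef
  have hLy : 0 ≤ L * y := by positivity
  have h2 : √(L * y) ^ 2 = L * y := Real.sq_sqrt hLy
  have h4 : √(L * y) ^ 4 = (L * y) ^ 2 := by linear_combination (√(L * y) ^ 2 + L * y) * h2
  refine isLeast_Q4 hd (fun _ => √(L * y)) ⟨?_, ?_, fun j => ⟨Real.sqrt_nonneg _, ?_⟩⟩ ?_ ?_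
  · rw [Q2_eq_iff hd]
    simp only [h2, Finset.sum_const, Finset.card_univ, Fintype.card_fin, nsmul_eq_mul]
    ring
  · simp only [Finset.sum_const, Finset.card_univ, Fintype.card_fin, nsmul_eq_mul]
    rw [mul_comm (x : ℝ)]
    refine abs_le_of_sq_le_sq' ?_ hs |>.2
    rw [le_div_iff₀ (by positivity)] at hy'
    rw [mul_pow, h2]
    linarith
  · have hd1 : (0 : ℝ) ≤ d - 1 := by linarith
    rw [Real.sqrt_le_left hd1]
    -- The mean square L y of any feasible point is at most (d - 1)², so the constant vector also
    -- obeys the cap.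
    have hq := (Q2_eq_iff hd τ y).1 hτ.1
    have : ∑ j, τ j ^ 2 ≤ ∑ _j : Fin (numReal d), ((d : ℝ) - 1) ^ 2 :=
      Finset.sum_le_sum fun j _ => pow_le_pow_left₀ (hτ.2.2 j).1 (hτ.2.2 j).2 2
    simp only [Finset.sum_const, Finset.card_univ, Fintype.card_fin, nsmul_eq_mul] at this
    rw [hq] at this
    exact le_of_mul_le_mul_left (by linarith) hL
  · simp only [h4, Finset.sum_const, Finset.card_univ, Fintype.card_fin, nsmul_eq_mul]
    ring
  · intro σ hσ
    have hq := (Q2_eq_iff hd σ y).1 hσ.1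
    have hcs := sq_sum_le_card_mul_sum_sq (s := Finset.univ) (f := fun j => σ j ^ 2)
    simp only [Finset.card_univ, Fintype.card_fin, hq, ← pow_mul] at hcs
    simp only [h4, Finset.sum_const, Finset.card_univ, Fintype.card_fin, nsmul_eq_mul]
    refine le_of_mul_le_mul_left ?_ hL
    refine le_trans (le_of_eq ?_) hcs
    ring

theorem exists_isBranch {d x : ℕ} {y : ℝ} (hd : 2 ≤ d)
    (hlo : ((d : ℝ) * x - 1) ^ 2 / (numReal d : ℝ) ^ 3 < y)
    (hhi : y < ((d : ℝ) * x - 1) ^ 2 / (numReal d : ℝ) ^ 2) : ∃ n, IsBranch d n x y := by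
  have hL : (0 : ℝ) < numReal d := by exact_mod_cast (two_pos.trans_le (two_le_numReal hd))
  have hy0 : 0 < y := lt_of_le_of_lt (by positivity) hlo
  -- The branch conditions say n < z ≤ n + 1, whence n = ⌈z⌉ - 1.
  set z := ((d : ℝ) * x - 1) ^ 2 / ((numReal d : ℝ) ^ 2 * y) with hz
  have hz1 : 1 < z := by
    rw [lt_div_iff₀ (by positivity)] at hhi ⊢
    linarith
  have hzL : z < numReal d := by
    rw [div_lt_iff₀ (by positivity)] at hlo ⊢
    linarith
  have hceil : 1 < ⌈z⌉₊ := by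
    rw [Nat.lt_ceil]
    exact_mod_cast hz1
  have hceilL : ⌈z⌉₊ ≤ numReal d := Nat.ceil_le.2 hzL.le
  obtain ⟨n, hn⟩ : ∃ n, ⌈z⌉₊ = n + 1 := ⟨⌈z⌉₊ - 1, by omega⟩
  have hn1 : 1 ≤ n := by omega
  have hnpos : (0 : ℝ) < n := by exact_mod_cast hn1
  have h1 : z ≤ n + 1 := by
    have := Nat.le_ceil z
    rw [hn] at this
    exact_mod_cast this
  have h2 : (n : ℝ) < z := Nat.lt_ceil.1 (by omega)
  refine ⟨n, hn1, by omega, ?_, ?_⟩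
  · rw [div_le_iff₀ (by positivity)] at h1 ⊢
    linarith
  · rw [lt_div_iff₀ (by positivity)] at h2 ⊢
    linarith

theorem isLeast_branch {d n x : ℕ} {y : ℝ} (hd : 2 ≤ d) (hx : 1 ≤ x)
    (hn : IsBranch d n x y) (hne : (feasible d x y).Nonempty) :
    IsLeast (Q4 d '' feasible d x y) (FminBranch d n x y) := by
  have hL2 := two_le_numReal hd
  have hL : (0 : ℝ) < numReal d := by exact_mod_cast (two_pos.trans_le hL2)
  have hd' : (2 : ℝ) ≤ d := by exact_mod_cast hd
  have hx' : (1 : ℝ) ≤ x := by exact_mod_cast hx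
  have hs : 0 ≤ (d : ℝ) * x - 1 := by nlinarith
  obtain ⟨hn1, hnL, hlo, hhi⟩ := hn
  obtain ⟨σ, hσ⟩ := hne
  have hnpos : (0 : ℝ) < n := by exact_mod_cast hn1
  rw [div_le_iff₀ (by positivity)] at hlo
  rw [lt_div_iff₀ (by positivity)] at hhi
  set s : ℝ := (d : ℝ) * x - 1 with hsdef
  have harg : (n : ℝ) * (n + 1) * (numReal d : ℝ) ^ 2 * y - n * s ^ 2
      = n * (y * ((numReal d : ℝ) ^ 2 * (n + 1)) - s ^ 2) := by ring
  have hB2 : calB d n x y ^ 2 = n * (n + 1) * (numReal d : ℝ) ^ 2 * y - n * s ^ 2 := by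
    refine Real.sq_sqrt ?_
    rw [← hsdef, harg]
    exact mul_nonneg hnpos.le (by linarith)
  have hB0 : 0 ≤ calB d n x y := Real.sqrt_nonneg _
  set B := calB d n x y with hBdef
  have hBs : B ≤ s := by
    refine abs_le_of_sq_le_sq' ?_ hs |>.2
    rw [hB2]
    nlinarith
  -- The root with a ≥ b of n a + b = s, n a² + b² = L²y. The lower end of the branch makes the
  -- radicand nonnegative, the upper end gives B ≤ s, that is b ≥ 0.
  set a : ℝ := (B + n * s) / (n * (n + 1)) with ha
  set b : ℝ := (s - B) / (n + 1) with hb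
  have hb0 : 0 ≤ b := div_nonneg (by linarith) (by positivity)
  have hba : b ≤ a := by
    rw [ha, hb, div_le_div_iff₀ (by positivity) (by positivity)]
    nlinarith [mul_nonneg hB0 (sq_nonneg ((n : ℝ) + 1))]
  have hsum : n * a + b = s := by rw [ha, hb]; field_simp; ring
  have hsq : n * a ^ 2 + b ^ 2 = (numReal d : ℝ) ^ 2 * y := by
    have : n * a ^ 2 + b ^ 2 = (B ^ 2 + n * s ^ 2) / (n * (n + 1)) := by
      rw [ha, hb]; field_simp; ring
    rw [this, hB2]
    field_simp
    ring
  have hle : ∀ τ ∈ feasible d x y, ∑ j, τ j ≤ n * a + b := fun τ hτ => by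
    rw [hsum, hsdef, mul_comm]
    exact hτ.2.1
  have hqe : ∀ τ ∈ feasible d x y, ∑ j, τ j ^ 2 = n * a ^ 2 + b ^ 2 := fun τ hτ => by
    rw [hsq, (Q2_eq_iff hd τ y).1 hτ.1]
  have haM : a ≤ (d : ℝ) - 1 := stepHeight_le σ hn1 (fun j => (hσ.2.2 j).1) hb0 hba
    (by linarith) (fun j => (hσ.2.2 j).2) (hqe σ hσ) (hle σ hσ)
  have hnL' : n < numReal d := by omega
  have h4 := sum_stepVector hnL' a b (fun t => t ^ 4) (by simp)
  refine isLeast_Q4 hd (stepVector _ n a b) ⟨?_, ?_, fun j => stepVector_mem hb0 hba haM j⟩ ?_ ?_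
  · rw [Q2_eq_iff hd, ← hsq]
    exact sum_stepVector hnL' a b (fun t => t ^ 2) (by simp)
  · have := sum_stepVector hnL' a b (fun t => t) rfl
    rw [this, hsum, hsdef, mul_comm]
  · rw [h4, FminBranch, fAux, ← hBdef, ← hsdef, ha, hb]
    field_simp
    ring
  · intro τ hτ
    rw [h4]
    exact sum_pow_four_ge τ n (fun j => (hτ.2.2 j).1) hb0 hba (hqe τ hτ) (hle τ hτ)

/-- `Fmin` is the minimum of the optimization problem. -/
theorem isLeast_Fmin {d x : ℕ} {y : ℝ} (hd : 2 ≤ d) (hx : 1 ≤ x) (hy : 0 ≤ y)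
    (hhi : y < ((d : ℝ) * x - 1) ^ 2 / (numReal d : ℝ) ^ 2) (hne : (feasible d x y).Nonempty) :
    IsLeast (Q4 d '' feasible d x y) (Fmin d x y) := by
  unfold Fmin
  split_ifs with h1 h2
  · exact isLeast_of_le hd hx hy h1.2 hne
  · exact isLeast_branch hd hx h2.choose_spec hne
  · exact absurd (exists_isBranch hd (not_le.1 fun h => h1 ⟨hy, h⟩) hhi) h2

/-! ### Real Gell-Mann matrices: orthogonality and Bessel's inequality -/

theorem card_realIdx {d : ℕ} (hd : 1 ≤ d) : Fintype.card (RealIdx d) = numReal d := by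
  have h1 : Fintype.card {p : Fin d × Fin d // p.1 < p.2} = ∑ j ∈ Finset.range d, j := by
    rw [Fintype.card_subtype, Finset.card_filter, Fintype.sum_prod_type_right,
      ← Fin.sum_univ_eq_sum_range (fun j => j) d]
    refine Finset.sum_congr rfl fun j _ => ?_
    rw [← Finset.card_filter, Finset.filter_gt_eq_Iio, Fin.card_Iio]
  rw [Fintype.card_sum, h1, Fintype.card_fin, numReal]
  have h2 := Finset.sum_range_id_mul_two d
  obtain ⟨e, rfl⟩ := Nat.exists_eq_add_of_le hd
  simp only [Nat.add_sub_cancel_left] at *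
  symm
  apply Nat.div_eq_of_eq_mul_left two_pos
  rw [add_mul, h2]
  ring

theorem realGGM_conjTranspose {d : ℕ} (a : RealIdx d) : (realGGM d a).conjTranspose = realGGM d a := by
  rcases a with p | l
  · simp [realGGM, add_comm]
  · simp only [realGGM, Matrix.conjTranspose_smul, Matrix.diagonal_conjTranspose]
    congr 1
    · simp
    · congr 1
      ext j
      simp only [Pi.star_apply]
      split_ifs <;> simp

theorem realGGM_transpose {d : ℕ} (a : RealIdx d) : (realGGM d a).transpose = realGGM d a := by
  rcases a with p | l
  · simp [realGGM, add_comm]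
  · simp [realGGM]

/-- The diagonal of the `l`-th diagonal Gell-Mann matrix, before normalization. -/
def diagEntry (l j : ℕ) : ℂ := if j ≤ l then 1 else if j = l + 1 then -((l : ℂ) + 1) else 0

/-- Taking c = 1 yields tracelessness and orthogonality of different diagonal matrices; c = -(m + 1)
yields the norm (m + 1)(m + 2). -/
theorem sum_diagEntry_mul {d m : ℕ} (hm : m + 1 < d) (c : ℂ) (g : ℕ → ℂ)
    (hg : ∀ j ≤ m, g j = 1) (hc : g (m + 1) = c) :
    ∑ j : Fin d, g j * diagEntry m j = (m + 1) * (1 - c) := by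
  rw [Fin.sum_univ_eq_sum_range (fun j => g j * diagEntry m j) d,
    ← Finset.sum_subset (Finset.range_mono (Nat.succ_le_of_lt hm)), Nat.succ_eq_add_one,
    Finset.sum_range_succ, hc, Finset.sum_congr rfl (g := fun _ => (1 : ℂ))]
  · simp [diagEntry]
    ring
  · intro j hj
    have : j ≤ m := Nat.lt_succ_iff.1 (Finset.mem_range.1 hj)
    simp [hg j this, diagEntry, this]
  · intro j _ hj
    have : ¬ j < m + 2 := fun h => hj (Finset.mem_range.2 h)
    rw [diagEntry, if_neg (by omega), if_neg (by omega), mul_zero]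

theorem realGGM_inr {d : ℕ} (l : Fin (d - 1)) : realGGM d (Sum.inr l) =
    ((Real.sqrt ((d : ℝ) / (((l : ℝ) + 1) * ((l : ℝ) + 2))) : ℝ) : ℂ) •
        Matrix.diagonal (fun j : Fin d => diagEntry l j) := rfl

theorem trace_realGGM {d : ℕ} (a : RealIdx d) : (realGGM d a).trace = 0 := by
  rcases a with p | l
  · have := p.2.ne
    simp [realGGM, Matrix.trace_single_eq_of_ne _ _ _ this, Matrix.trace_single_eq_of_ne _ _ _ this.symm]
  · rw [realGGM_inr, Matrix.trace_smul, Matrix.trace_diagonal]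
    have := sum_diagEntry_mul (d := d) (m := l) (by omega) 1 (fun _ => 1)
      (by simp) rfl
    simp only [one_mul] at this
    rw [this]
    simp

theorem trace_realGGM_mul {d : ℕ} (a b : RealIdx d) :
    (realGGM d a * realGGM d b).trace = if a = b then (d : ℂ) else 0 := by
  rcases a with p | l <;> rcases b with q | m
  · obtain ⟨⟨p1, p2⟩, hp⟩ := p
    obtain ⟨⟨q1, q2⟩, hq⟩ := q
    have hs : ((√((d : ℝ) / 2) : ℝ) : ℂ) * ((√((d : ℝ) / 2) : ℝ) : ℂ) = (d : ℂ) / 2 := by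
      rw [← Complex.ofReal_mul, Real.mul_self_sqrt (by positivity)]
      simp
    simp only [realGGM, Matrix.smul_mul, Matrix.mul_smul, Matrix.trace_smul, smul_smul, hs,
      add_mul, Matrix.trace_add, smul_eq_mul, Matrix.trace_single_mul, Matrix.add_apply,
      Matrix.single_apply, Sum.inl.injEq, Subtype.mk.injEq, Prod.mk.injEq]
    simp only at hp hq
    by_cases h : p1 = q1 ∧ p2 = q2
    · obtain ⟨rfl, rfl⟩ := h
      simp [hp.ne, hp.ne']
      ring
    · have h' : ¬ (q1 = p1 ∧ q2 = p2) := fun h' => h ⟨h'.1.symm, h'.2.symm⟩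
      have h'' : ¬ (q1 = p2 ∧ q2 = p1) := fun h' => by
        obtain ⟨rfl, rfl⟩ := h'
        exact lt_asymm hp hq
      have h3 : ¬ (q2 = p2 ∧ q1 = p1) := fun h => h' h.symm
      have h4 : ¬ (q2 = p1 ∧ q1 = p2) := fun h => h'' h.symm
      simp [h, h', h'', h3, h4]
  · obtain ⟨⟨p1, p2⟩, hp⟩ := p
    simp only at hp
    rw [realGGM_inr]
    simp [realGGM, add_mul, Matrix.trace_single_mul, hp.ne, hp.ne']
  · obtain ⟨⟨p1, p2⟩, hp⟩ := q
    simp only at hp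
    rw [realGGM_inr, Matrix.trace_mul_comm]
    simp [realGGM, add_mul, Matrix.trace_single_mul, hp.ne, hp.ne']
  · rw [realGGM_inr, realGGM_inr]
    simp only [Matrix.smul_mul, Matrix.mul_smul, Matrix.trace_smul, smul_smul,
      Matrix.diagonal_mul_diagonal, Matrix.trace_diagonal, Sum.inr.injEq]
    rcases lt_trichotomy l m with h | rfl | h
    · have h' : (l : ℕ) < m := h
      have := sum_diagEntry_mul (d := d) (m := l) (by omega) 1 (diagEntry m)
        (fun j hj => by simp [diagEntry, hj.trans h'.le])
        (by simp [diagEntry, Nat.succ_le_of_lt h'])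
      simp only [mul_comm] at this ⊢
      simp [this, h.ne]
    · have := sum_diagEntry_mul (d := d) (m := l) (by omega)
        (-((l : ℂ) + 1)) (diagEntry l)
        (fun j hj => by simp [diagEntry, hj]) (by simp [diagEntry])
      rw [this, ← Complex.ofReal_mul, Real.mul_self_sqrt (by positivity)]
      have h1 : ((l : ℕ) : ℂ) + 1 ≠ 0 := by exact_mod_cast Nat.succ_ne_zero (l : ℕ)
      have h2 : ((l : ℕ) : ℂ) + 2 ≠ 0 := by exact_mod_cast Nat.succ_ne_zero ((l : ℕ) + 1)
      simp
      field_simp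
      ring
    · have h' : (m : ℕ) < l := h
      have := sum_diagEntry_mul (d := d) (m := m) (by omega) 1 (diagEntry l)
        (fun j hj => by simp [diagEntry, hj.trans h'.le])
        (by simp [diagEntry, Nat.succ_le_of_lt h'])
      simp [this, h.ne']

/-- Bessel's inequality for the orthogonal family of the identity and the real generalized
Gell-Mann matrices. -/
theorem bessel_realGGM {d : ℕ} (hd : 1 ≤ d) (X : Matrix (Fin d) (Fin d) ℂ) :
    ‖X.trace‖ ^ 2 + ∑ a, ‖(realGGM d a * X).trace‖ ^ 2 ≤ d * ∑ i, ∑ j, ‖X i j‖ ^ 2 := by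
  classical
  have hd0 : (0 : ℝ) < d := by exact_mod_cast hd
  let G : Option (RealIdx d) → Matrix (Fin d) (Fin d) ℂ := fun o => o.elim 1 (realGGM d)
  have hG : ∀ o, (G o).conjTranspose = G o := by
    rintro (_ | a)
    · simp [G]
    · exact realGGM_conjTranspose a
  have hGG : ∀ o o', (G o * G o').trace = if o = o' then (d : ℂ) else 0 := by
    rintro (_ | a) (_ | b)
    · simp [G]
    · simp [G, trace_realGGM]
    · simp [G, trace_realGGM]
    · simp [G, trace_realGGM_mul]
  let vec : Matrix (Fin d) (Fin d) ℂ → EuclideanSpace ℂ (Fin d × Fin d) :=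
    fun A => WithLp.toLp 2 fun p => A p.1 p.2
  have hinner : ∀ A B, inner ℂ (vec A) (vec B) = (A.conjTranspose * B).trace := by
    intro A B
    simp only [vec, PiLp.inner_apply, Fintype.sum_prod_type, Matrix.trace, Matrix.diag_apply,
      Matrix.mul_apply, Matrix.conjTranspose_apply, RCLike.inner_apply, RCLike.star_def]
    rw [Finset.sum_comm]
    exact Finset.sum_congr rfl fun i _ => Finset.sum_congr rfl fun j _ => mul_comm _ _
  let e : Option (RealIdx d) → EuclideanSpace ℂ (Fin d × Fin d) :=
    fun o => (((√(d : ℝ))⁻¹ : ℝ) : ℂ) • vec (G o)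
  have he : Orthonormal ℂ e := by
    rw [orthonormal_iff_ite]
    intro o o'
    simp only [e, inner_smul_left, inner_smul_right, hinner, hG, hGG, Complex.conj_ofReal]
    split_ifs
    · rw [← mul_assoc, ← Complex.ofReal_mul, ← mul_inv, Real.mul_self_sqrt hd0.le]
      simp [show (d : ℂ) ≠ 0 by exact_mod_cast hd0.ne']
    · simp
  have hb := he.sum_inner_products_le (x := vec X) (s := Finset.univ)
  have hn : ‖vec X‖ ^ 2 = ∑ i, ∑ j, ‖X i j‖ ^ 2 := by
    rw [EuclideanSpace.norm_sq_eq, Fintype.sum_prod_type]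
  have ht : ∀ o, ‖inner ℂ (e o) (vec X)‖ ^ 2 = (d : ℝ)⁻¹ * ‖(G o * X).trace‖ ^ 2 := by
    intro o
    simp only [e, inner_smul_left, hinner, hG, norm_mul, mul_pow, Complex.conj_ofReal,
      Complex.norm_real, Real.norm_eq_abs, sq_abs, inv_pow, Real.sq_sqrt hd0.le]
  simp only [ht, hn, ← Finset.mul_sum, Fintype.sum_option] at hb
  rw [inv_mul_le_iff₀ hd0] at hb
  simpa [G] using hb

/-! ### Pure states: bound on a single correlation -/

/-- The coefficient matrix of a vector of `ℂ^d ⊗ ℂ^d`. -/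
def coeffMatrix {d : ℕ} (ψ : Fin d × Fin d → ℂ) : Matrix (Fin d) (Fin d) ℂ :=
  Matrix.of fun i j => ψ (i, j)

theorem trace_pure_mul_kronecker {d : ℕ} (ψ : Fin d × Fin d → ℂ) (A B : Matrix (Fin d) (Fin d) ℂ) :
    (Matrix.vecMulVec ψ (star ψ) * (A ⊗ₖ B)).trace
      = ((coeffMatrix ψ).conjTranspose * A * coeffMatrix ψ * B.transpose).trace := by
  simp only [Matrix.trace, Matrix.diag_apply, Matrix.mul_apply, Matrix.vecMulVec_apply,
    Matrix.kroneckerMap_apply, Matrix.conjTranspose_apply, Matrix.transpose_apply, coeffMatrix,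
    Matrix.of_apply, Pi.star_apply, Fintype.sum_prod_type, Finset.sum_mul]
  rw [Finset.sum_comm]
  symm
  rw [Finset.sum_comm]
  refine Finset.sum_congr rfl fun j _ => ?_
  rw [Finset.sum_comm]
  refine Finset.sum_congr rfl fun i _ => ?_
  rw [Finset.sum_comm]
  refine Finset.sum_congr rfl fun k _ => Finset.sum_congr rfl fun l _ => ?_
  ring

/-- The squared Frobenius norm. -/
def frobSq {m n : Type*} [Fintype m] [Fintype n] (X : Matrix m n ℂ) : ℝ := ∑ i, ∑ j, ‖X i j‖ ^ 2

theorem trace_conjTranspose_mul_self {m n : Type*} [Fintype m] [Fintype n] (X : Matrix m n ℂ) :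
    (X.conjTranspose * X).trace = (frobSq X : ℂ) := by
  simp only [frobSq, Matrix.trace, Matrix.diag_apply, Matrix.mul_apply,
    Matrix.conjTranspose_apply, Complex.ofReal_sum]
  rw [Finset.sum_comm]
  refine Finset.sum_congr rfl fun i _ => Finset.sum_congr rfl fun j _ => ?_
  rw [RCLike.star_def, Complex.conj_mul']
  push_cast
  rfl

theorem frobSq_conjTranspose {m n : Type*} [Fintype m] [Fintype n] (X : Matrix m n ℂ) :
    frobSq X.conjTranspose = frobSq X := by
  simp only [frobSq, Matrix.conjTranspose_apply, norm_star]
  exact Finset.sum_comm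

theorem frobSq_unitary_mul {n : Type*} [Fintype n] [DecidableEq n] {U X : Matrix n n ℂ}
    (hU : U.conjTranspose * U = 1) : frobSq (U * X) = frobSq X := by
  have : (frobSq (U * X) : ℂ) = frobSq X := by
    rw [← trace_conjTranspose_mul_self, ← trace_conjTranspose_mul_self, Matrix.conjTranspose_mul,
      Matrix.mul_assoc, ← Matrix.mul_assoc _ U, hU, Matrix.one_mul]
  exact_mod_cast this

theorem exists_unitary_diagonal {n : Type*} [Fintype n] [DecidableEq n] {A : Matrix n n ℂ}
    (hA : A.IsHermitian) : ∃ U : Matrix n n ℂ, U.conjTranspose * U = 1 ∧ U * U.conjTranspose = 1 ∧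
      A = U * Matrix.diagonal (fun i => (hA.eigenvalues i : ℂ)) * U.conjTranspose := by
  refine ⟨hA.eigenvectorUnitary, ?_, ?_, ?_⟩
  · exact Unitary.coe_star_mul_self hA.eigenvectorUnitary
  · exact Unitary.coe_mul_star_self hA.eigenvectorUnitary
  · conv_lhs => rw [hA.spectral_theorem, Unitary.conjStarAlgAut_apply]
    rfl

/-- A traceless Hermitian matrix of size `d` with squared Frobenius norm at most `d` has operator
norm at most `√(d-1)`. -/
theorem frobSq_mul_le_of_trace_eq_zero {d : ℕ} {A : Matrix (Fin d) (Fin d) ℂ}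
    (hA : A.IsHermitian) (htr : A.trace = 0) (hF : frobSq A ≤ d) (X : Matrix (Fin d) (Fin d) ℂ) :
    frobSq (A * X) ≤ (d - 1) * frobSq X := by
  obtain ⟨U, hU1, hU2, hUA⟩ := exists_unitary_diagonal hA
  set e := hA.eigenvalues
  have hU1' : U.conjTranspose.conjTranspose * U.conjTranspose = 1 := by simpa using hU2
  have hAX : ∀ Y, frobSq (A * Y) = ∑ i, e i ^ 2 * ∑ j, ‖(U.conjTranspose * Y) i j‖ ^ 2 := by
    intro Y
    rw [hUA, Matrix.mul_assoc, Matrix.mul_assoc, frobSq_unitary_mul hU1, frobSq]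
    refine Finset.sum_congr rfl fun i _ => ?_
    rw [Finset.mul_sum]
    refine Finset.sum_congr rfl fun j _ => ?_
    rw [Matrix.diagonal_mul, norm_mul, mul_pow, Complex.norm_real, Real.norm_eq_abs, sq_abs]
  have hsum : ∑ i, e i = 0 := by
    have := hA.trace_eq_sum_eigenvalues
    rw [htr] at this
    refine Complex.ofReal_injective ?_
    rw [Complex.ofReal_sum, Complex.ofReal_zero]
    exact this.symm
  have hsq : ∑ i, e i ^ 2 ≤ d := by
    have h := hAX U
    rw [hU1, ← frobSq_conjTranspose, Matrix.conjTranspose_mul, frobSq_unitary_mul hU1',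
      frobSq_conjTranspose] at h
    rw [h] at hF
    refine le_trans (le_of_eq ?_) hF
    refine Finset.sum_congr rfl fun i _ => ?_
    rw [Finset.sum_eq_single i]
    · simp
    · intro j _ hj
      simp [Matrix.one_apply_ne hj.symm]
    · simp
  -- The other d - 1 eigenvalues sum to -e_i, so Cauchy-Schwarz gives e_i² ≤ (d - 1)(d - e_i²).
  have he : ∀ i, e i ^ 2 ≤ d - 1 := by
    intro i
    have h1 := Finset.add_sum_erase Finset.univ e (Finset.mem_univ i)
    have h2 := Finset.add_sum_erase Finset.univ (fun i => e i ^ 2) (Finset.mem_univ i)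
    have h3 := sq_sum_le_card_mul_sum_sq (s := Finset.univ.erase i) (f := e)
    have hd : 1 ≤ d := Nat.one_le_of_lt i.2
    rw [Finset.card_erase_of_mem (Finset.mem_univ i), Finset.card_univ, Fintype.card_fin,
      Nat.cast_sub hd, Nat.cast_one] at h3
    have hd' : (1 : ℝ) ≤ d := by exact_mod_cast hd
    have h4 : ∑ j ∈ Finset.univ.erase i, e j = - e i := by linarith
    have h5 : ∑ j ∈ Finset.univ.erase i, e j ^ 2 ≤ d - e i ^ 2 := by linarith
    rw [h4] at h3
    have h6 := mul_le_mul_of_nonneg_left h5 (sub_nonneg.2 hd')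
    have h7 : (d : ℝ) * e i ^ 2 ≤ d * (d - 1) := by nlinarith
    exact le_of_mul_le_mul_left h7 (by linarith)
  rw [hAX, ← frobSq_unitary_mul hU1' (X := X), frobSq, Finset.mul_sum]
  exact Finset.sum_le_sum fun i _ => mul_le_mul_of_nonneg_right (he i)
    (Finset.sum_nonneg fun j _ => sq_nonneg _)

/-- A real combination of the real generalized Gell-Mann matrices. -/
def ggmComb {d : ℕ} (u : RealIdx d → ℝ) : Matrix (Fin d) (Fin d) ℂ := ∑ a, (u a : ℂ) • realGGM d a

theorem ggmComb_conjTranspose {d : ℕ} (u : RealIdx d → ℝ) :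
    (ggmComb u).conjTranspose = ggmComb u := by
  simp [ggmComb, Matrix.conjTranspose_sum, Matrix.conjTranspose_smul, realGGM_conjTranspose]

theorem ggmComb_transpose {d : ℕ} (u : RealIdx d → ℝ) :
    (ggmComb u).transpose = ggmComb u := by
  simp [ggmComb, Matrix.transpose_sum, Matrix.transpose_smul, realGGM_transpose]

theorem trace_ggmComb {d : ℕ} (u : RealIdx d → ℝ) : (ggmComb u).trace = 0 := by
  simp [ggmComb, Matrix.trace_sum, Matrix.trace_smul, trace_realGGM]

theorem frobSq_ggmComb {d : ℕ} (u : RealIdx d → ℝ) : frobSq (ggmComb u) = d * ∑ a, u a ^ 2 := by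
  have : (frobSq (ggmComb u) : ℂ) = ((d * ∑ a, u a ^ 2 : ℝ) : ℂ) := by
    rw [← trace_conjTranspose_mul_self, ggmComb_conjTranspose, ggmComb]
    simp only [Finset.sum_mul, Finset.mul_sum, Matrix.trace_sum, Matrix.smul_mul, Matrix.mul_smul,
      Matrix.trace_smul, trace_realGGM_mul, smul_eq_mul, mul_ite, mul_zero]
    push_cast
    refine Finset.sum_congr rfl fun a _ => ?_
    simp
    ring
  exact_mod_cast this

theorem trace_mul_ggmComb {d : ℕ} (ρ : BipartiteOp d) (u v : RealIdx d → ℝ) :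
    (ρ * (ggmComb u ⊗ₖ ggmComb v)).trace.re = ∑ a, ∑ b, u a * v b * corrReal ρ a b := by
  have : ρ * (ggmComb u ⊗ₖ ggmComb v)
      = ∑ a, ∑ b, (((u a * v b : ℝ) : ℂ)) • (ρ * (realGGM d a ⊗ₖ realGGM d b)) := by
    have hk : ggmComb u ⊗ₖ ggmComb v
        = ∑ a, ∑ b, (((u a * v b : ℝ) : ℂ)) • (realGGM d a ⊗ₖ realGGM d b) := by
      ext i j
      simp only [ggmComb, Matrix.kroneckerMap_apply, Matrix.sum_apply, Matrix.smul_apply,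
        smul_eq_mul, Finset.sum_mul_sum]
      refine Finset.sum_congr rfl fun a _ => Finset.sum_congr rfl fun b _ => ?_
      push_cast
      ring
    rw [hk, Finset.mul_sum]
    simp only [Finset.mul_sum, Matrix.mul_smul]
  rw [this]
  simp only [Matrix.trace_sum, Matrix.trace_smul, Complex.re_sum, smul_eq_mul,
    Complex.re_ofReal_mul, corrReal, Matrix.of_apply]

theorem frobSq_coeffMatrix {d : ℕ} (ψ : Fin d × Fin d → ℂ) :
    frobSq (coeffMatrix ψ) = ∑ i, ‖ψ i‖ ^ 2 := by
  rw [Fintype.sum_prod_type]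
  rfl

/-- Correlations of pure states along unit vectors are at most `d - 1`. -/
theorem corrReal_pure_le {d : ℕ} (ψ : Fin d × Fin d → ℂ) (hψ : ∑ i, ‖ψ i‖ ^ 2 = 1)
    (u v : RealIdx d → ℝ) (hu : ∑ a, u a ^ 2 ≤ 1) (hv : ∑ a, v a ^ 2 ≤ 1) :
    ∑ a, ∑ b, u a * v b * corrReal (Matrix.vecMulVec ψ (star ψ)) a b ≤ d - 1 := by
  set M := coeffMatrix ψ with hM
  have hM1 : frobSq M = 1 := by rw [hM, frobSq_coeffMatrix, hψ]
  have key : ∀ w : RealIdx d → ℝ, ∑ a, w a ^ 2 ≤ 1 → ∀ X : Matrix (Fin d) (Fin d) ℂ,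
      frobSq (ggmComb w * X) ≤ (d - 1) * frobSq X := fun w hw X =>
    frobSq_mul_le_of_trace_eq_zero (ggmComb_conjTranspose w) (trace_ggmComb w)
      (by rw [frobSq_ggmComb]; exact mul_le_of_le_one_right (Nat.cast_nonneg d) hw) X
  have h1 := key u hu M
  have h2 := key v hv M.conjTranspose
  rw [← frobSq_conjTranspose, Matrix.conjTranspose_mul, Matrix.conjTranspose_conjTranspose,
    ggmComb_conjTranspose, frobSq_conjTranspose] at h2
  have h3 : (M.conjTranspose * ggmComb u * M * (ggmComb v).transpose).trace
      = ∑ i, ∑ j, star ((ggmComb u * M) i j) * (M * ggmComb v) i j := by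
    have : M.conjTranspose * ggmComb u * M * (ggmComb v).transpose
        = (ggmComb u * M).conjTranspose * (M * ggmComb v) := by
      rw [Matrix.conjTranspose_mul, ggmComb_conjTranspose, ggmComb_transpose, Matrix.mul_assoc,
        Matrix.mul_assoc]
    rw [this, Matrix.trace, Finset.sum_comm]
    refine Finset.sum_congr rfl fun i _ => ?_
    rw [Matrix.diag_apply, Matrix.mul_apply]
    rfl
  rw [← trace_mul_ggmComb, trace_pure_mul_kronecker, ← hM, h3]
  have h4 : (∑ i, ∑ j, star ((ggmComb u * M) i j) * (M * ggmComb v) i j).re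
      ≤ (frobSq (ggmComb u * M) + frobSq (M * ggmComb v)) / 2 := by
    rw [frobSq, frobSq, ← Finset.sum_add_distrib, Finset.sum_div, Complex.re_sum]
    refine Finset.sum_le_sum fun i _ => ?_
    rw [← Finset.sum_add_distrib, Finset.sum_div, Complex.re_sum]
    refine Finset.sum_le_sum fun j _ => ?_
    refine (Complex.re_le_norm _).trans ?_
    rw [norm_mul, norm_star]
    nlinarith [sq_nonneg (‖(ggmComb u * M) i j‖ - ‖(M * ggmComb v) i j‖)]
  rw [hM1] at h1 h2
  linarith

/-! ### Pure states: trace-norm bound -/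

/-- The squared norm of a column. -/
def colSq {d : ℕ} (N : Matrix (Fin d) (Fin d) ℂ) (i : Fin d) : ℝ := ∑ j, ‖N j i‖ ^ 2

theorem bessel_columns {d : ℕ} (N : Matrix (Fin d) (Fin d) ℂ) (i k : Fin d) :
    ‖(N.conjTranspose * N) i k‖ ^ 2 + ∑ a, ‖(N.conjTranspose * realGGM d a * N) i k‖ ^ 2
      ≤ d * (colSq N i * colSq N k) := by
  -- With this rank-one X, the (i, k) entry of N†AN is tr(AX).
  set X : Matrix (Fin d) (Fin d) ℂ := Matrix.of fun p q => N p k * star (N q i) with hX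
  have h := bessel_realGGM (Nat.one_le_of_lt i.2) X
  have h1 : ∀ A : Matrix (Fin d) (Fin d) ℂ, (N.conjTranspose * A * N) i k = (A * X).trace := by
    intro A
    simp only [Matrix.trace, Matrix.diag_apply, Matrix.mul_apply, hX, Matrix.of_apply,
      Matrix.conjTranspose_apply, Finset.sum_mul]
    rw [Finset.sum_comm]
    refine Finset.sum_congr rfl fun p _ => Finset.sum_congr rfl fun q _ => ?_
    ring
  have h2 : ∑ p, ∑ q, ‖X p q‖ ^ 2 = colSq N i * colSq N k := by
    rw [mul_comm, colSq, colSq, Finset.sum_mul_sum]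
    simp [hX, mul_pow]
  have h3 := h1 1
  rw [Matrix.mul_one, Matrix.one_mul] at h3
  simp only [h1, h3]
  rwa [h2] at h

/-- Cauchy-Schwarz with an extra term. -/
theorem norm_add_sum_mul_le {J : Type*} [Fintype J] (x₀ y₀ : ℂ) (x y : J → ℂ) {c e : ℝ}
    (hx : ‖x₀‖ ^ 2 + ∑ j, ‖x j‖ ^ 2 ≤ c) (hy : ‖y₀‖ ^ 2 + ∑ j, ‖y j‖ ^ 2 ≤ e) :
    ‖x₀ * y₀ + ∑ j, x j * y j‖ ≤ √c * √e := by
  have h := Real.sum_mul_le_sqrt_mul_sqrt (Finset.univ : Finset (Option J))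
    (fun o => o.elim ‖x₀‖ fun j => ‖x j‖) (fun o => o.elim ‖y₀‖ fun j => ‖y j‖)
  simp only [Fintype.sum_option, Option.elim] at h
  refine le_trans ?_ (h.trans (mul_le_mul (Real.sqrt_le_sqrt hx) (Real.sqrt_le_sqrt hy)
    (Real.sqrt_nonneg _) (Real.sqrt_nonneg _)))
  refine (norm_add_le _ _).trans (add_le_add (norm_mul _ _).le ?_)
  exact (norm_sum_le _ _).trans (Finset.sum_le_sum fun j _ => (norm_mul _ _).le)

/-- Bessel's inequality for a real family acting on complex vectors. -/
def IsRealBessel {J ι : Type*} [Fintype J] [Fintype ι] (u : J → ι → ℝ) : Prop :=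
  ∀ α : ι → ℂ, ∑ j, ‖∑ a, (u j a : ℂ) * α a‖ ^ 2 ≤ ∑ a, ‖α a‖ ^ 2

/-- The u_j are real, so real and imaginary parts of α separate. -/
theorem isRealBessel_of_orthonormal {J ι : Type*} [Fintype J] [Fintype ι]
    {u : J → EuclideanSpace ℝ ι} (hu : Orthonormal ℝ u) : IsRealBessel fun j a => u j a := by
  intro α
  have hre := hu.sum_inner_products_le (x := WithLp.toLp 2 fun a => (α a).re) (s := Finset.univ)
  have him := hu.sum_inner_products_le (x := WithLp.toLp 2 fun a => (α a).im) (s := Finset.univ)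
  simp only [EuclideanSpace.norm_sq_eq, PiLp.inner_apply, Real.norm_eq_abs, sq_abs,
    RCLike.inner_apply, conj_trivial] at hre him
  have hn : ∀ z : ℂ, ‖z‖ ^ 2 = z.re ^ 2 + z.im ^ 2 := fun z => by
    rw [Complex.sq_norm, Complex.normSq_apply]; ring
  simp only [hn, Complex.re_sum, Complex.im_sum, Complex.re_ofReal_mul, Complex.im_ofReal_mul,
    Finset.sum_add_distrib]
  simp only [mul_comm (u _ _)]
  exact add_le_add hre him

theorem sq_sum_sqrt_le {ι : Type*} [Fintype ι] (c : ι → ℝ) (hc : ∀ i, 0 ≤ c i) {x : ℕ}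
    (hx : Fintype.card {i // c i ≠ 0} ≤ x) : (∑ i, √(c i)) ^ 2 ≤ x * ∑ i, c i := by
  classical
  have h1 : ∑ i, √(c i) = ∑ i with c i ≠ 0, √(c i) := by
    rw [Finset.sum_filter]
    refine Finset.sum_congr rfl fun i _ => ?_
    split_ifs with h
    · rfl
    · rw [not_not.1 h, Real.sqrt_zero]
  rw [h1]
  refine sq_sum_le_card_mul_sum_sq.trans ?_
  rw [← Fintype.card_subtype]
  refine mul_le_mul (by exact_mod_cast hx) ?_ (Finset.sum_nonneg fun _ _ => sq_nonneg _)
    (Nat.cast_nonneg _)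
  simp only [Real.sq_sqrt (hc _)]
  exact Finset.sum_le_univ_sum_of_nonneg hc

/-- The trace-norm bound for pure states of Schmidt rank at most `x`. -/
theorem one_add_sum_corrReal_pure_le {d x : ℕ} (ψ : Fin d × Fin d → ℂ)
    (hψ : ∑ i, ‖ψ i‖ ^ 2 = 1) (hr : schmidtRank ψ ≤ x) {J : Type*} [Fintype J]
    {u v : J → RealIdx d → ℝ} (hu : IsRealBessel u) (hv : IsRealBessel v) :
    1 + ∑ j, ∑ a, ∑ b, u j a * v j b * corrReal (Matrix.vecMulVec ψ (star ψ)) a b ≤ d * x := by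
  set M := coeffMatrix ψ with hM
  have hH : (M.conjTranspose * M).IsHermitian := Matrix.isHermitian_conjTranspose_mul_self M
  obtain ⟨U, hU1, hU2, hUH⟩ := exists_unitary_diagonal hH
  set N := M * U with hN
  have hNN : N.conjTranspose * N = Matrix.diagonal fun i => (hH.eigenvalues i : ℂ) := by
    calc N.conjTranspose * N = U.conjTranspose * (M.conjTranspose * M) * U := by
          simp only [hN, Matrix.conjTranspose_mul, Matrix.mul_assoc]
      _ = (U.conjTranspose * U) * Matrix.diagonal (fun i => (hH.eigenvalues i : ℂ))
            * (U.conjTranspose * U) := by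
          conv_lhs => rw [hUH]
          simp only [Matrix.mul_assoc]
      _ = _ := by rw [hU1, Matrix.one_mul, Matrix.mul_one]
  have hcol : ∀ (Y : Matrix (Fin d) (Fin d) ℂ) i, (Y.conjTranspose * Y) i i = colSq Y i := by
    intro Y i
    simp only [Matrix.mul_apply, Matrix.conjTranspose_apply, colSq, Complex.ofReal_sum]
    refine Finset.sum_congr rfl fun j _ => ?_
    rw [RCLike.star_def, Complex.conj_mul']
    push_cast
    rfl
  have hcN : ∀ i, colSq N i = hH.eigenvalues i := fun i => by
    have := hcol N i
    rw [hNN, Matrix.diagonal_apply_eq] at this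
    exact_mod_cast this.symm
  have hcU : ∀ i, colSq U i = 1 := fun i => by
    have := hcol U i
    rw [hU1, Matrix.one_apply_eq] at this
    exact_mod_cast this.symm
  have hc0 : ∀ i, 0 ≤ colSq N i := fun i => Finset.sum_nonneg fun _ _ => sq_nonneg _
  have hMF : frobSq M = 1 := by rw [hM, frobSq_coeffMatrix, hψ]
  have hcsum : ∑ i, colSq N i = 1 := by
    rw [← hMF, ← frobSq_conjTranspose M, ← frobSq_unitary_mul (U := U.conjTranspose)
      (by simpa using hU2), ← Matrix.conjTranspose_mul, frobSq_conjTranspose, ← hN]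
    exact Finset.sum_comm
  have hcard : Fintype.card {i // colSq N i ≠ 0} ≤ x := by
    simp only [hcN]
    rw [← hH.rank_eq_card_non_zero_eigs, Matrix.rank_conjTranspose_mul_self]
    exact hr
  -- The eigenbasis change is shared between the factors: N = MU has orthogonal columns with squared
  -- norms c_i, and U has unit columns.
  let α : Fin d → Fin d → RealIdx d → ℂ := fun i k a => (N.conjTranspose * realGGM d a * N) i k
  let β : Fin d → Fin d → RealIdx d → ℂ := fun i k b => (U.conjTranspose * realGGM d b * U) k i
  have hcorr : ∀ a b, (Matrix.vecMulVec ψ (star ψ) * (realGGM d a ⊗ₖ realGGM d b)).trace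
      = ∑ i, ∑ k, α i k a * β i k b := by
    intro a b
    rw [trace_pure_mul_kronecker, realGGM_transpose, ← hM]
    have : (M.conjTranspose * realGGM d a * M * realGGM d b).trace
        = ((N.conjTranspose * realGGM d a * N) * (U.conjTranspose * realGGM d b * U)).trace := by
      calc (M.conjTranspose * realGGM d a * M * realGGM d b).trace
          = ((U * U.conjTranspose) * (M.conjTranspose * realGGM d a * M) * (U * U.conjTranspose)
              * realGGM d b).trace := by
            rw [hU2, Matrix.one_mul, Matrix.mul_one]
        _ = (U * ((N.conjTranspose * realGGM d a * N) * (U.conjTranspose * realGGM d b))).trace := by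
            simp only [hN, Matrix.conjTranspose_mul, Matrix.mul_assoc]
        _ = _ := by
            rw [Matrix.trace_mul_comm]
            simp only [Matrix.mul_assoc]
    rw [this]
    simp only [Matrix.trace, Matrix.diag_apply, Matrix.mul_apply (M := N.conjTranspose * _ * N)]
    rfl
  have hone : ∑ i, ∑ k, (N.conjTranspose * N) i k * (U.conjTranspose * U) k i = 1 := by
    have : ∀ i, ∑ k, (N.conjTranspose * N) i k * (U.conjTranspose * U) k i = colSq N i := by
      intro i
      rw [← Matrix.mul_apply, hU1, Matrix.mul_one, hcol]
    simp only [this]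
    exact_mod_cast hcsum
  have hS : ∑ i, ∑ k, ((N.conjTranspose * N) i k * (U.conjTranspose * U) k i
        + ∑ j, (∑ a, (u j a : ℂ) * α i k a) * ∑ b, (v j b : ℂ) * β i k b)
      = 1 + ∑ j, ∑ a, ∑ b, ((u j a * v j b : ℝ) : ℂ)
        * (Matrix.vecMulVec ψ (star ψ) * (realGGM d a ⊗ₖ realGGM d b)).trace := by
    simp only [Finset.sum_add_distrib, hone, hcorr]
    congr 1
    rw [← Fintype.sum_prod_type', Finset.sum_comm]
    refine Finset.sum_congr rfl fun j _ => ?_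
    simp only [Finset.sum_mul_sum]
    rw [Finset.sum_comm]
    refine Finset.sum_congr rfl fun a _ => ?_
    rw [Finset.sum_comm]
    refine Finset.sum_congr rfl fun b _ => ?_
    rw [← Fintype.sum_prod_type', Finset.mul_sum]
    refine Finset.sum_congr rfl fun p _ => ?_
    push_cast
    ring
  have hre : 1 + ∑ j, ∑ a, ∑ b, u j a * v j b * corrReal (Matrix.vecMulVec ψ (star ψ)) a b
      = (∑ i, ∑ k, ((N.conjTranspose * N) i k * (U.conjTranspose * U) k i
        + ∑ j, (∑ a, (u j a : ℂ) * α i k a) * ∑ b, (v j b : ℂ) * β i k b)).re := by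
    rw [hS]
    simp only [Complex.add_re, Complex.one_re, Complex.re_sum, Complex.re_ofReal_mul, corrReal,
      Matrix.of_apply]
  -- Keeping the identity term inside Cauchy-Schwarz is what produces the 1 in the final bound.
  have hterm : ∀ i k, ‖(N.conjTranspose * N) i k * (U.conjTranspose * U) k i
        + ∑ j, (∑ a, (u j a : ℂ) * α i k a) * ∑ b, (v j b : ℂ) * β i k b‖
      ≤ d * (√(colSq N i) * √(colSq N k)) := by
    intro i k
    refine (norm_add_sum_mul_le _ _ _ _
      ((add_le_add le_rfl (hu (α i k))).trans (bessel_columns N i k))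
      ((add_le_add le_rfl (hv (β i k))).trans (bessel_columns U k i))).trans (le_of_eq ?_)
    rw [hcU, hcU, mul_one, mul_one, Real.sqrt_mul (Nat.cast_nonneg d), Real.sqrt_mul (hc0 i)]
    linear_combination (√(colSq N i) * √(colSq N k)) * Real.mul_self_sqrt (Nat.cast_nonneg (α := ℝ) d)
  rw [hre]
  calc _ ≤ ∑ i, ∑ k, (d : ℝ) * (√(colSq N i) * √(colSq N k)) :=
        (Complex.re_le_norm _).trans ((norm_sum_le _ _).trans (Finset.sum_le_sum fun i _ =>
          (norm_sum_le _ _).trans (Finset.sum_le_sum fun k _ => hterm i k)))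
    _ = d * (∑ i, √(colSq N i)) ^ 2 := by
        simp only [← Finset.mul_sum, sq, Finset.sum_mul_sum]
    _ ≤ d * (x * ∑ i, colSq N i) :=
        mul_le_mul_of_nonneg_left (sq_sum_sqrt_le _ hc0 hcard) (Nat.cast_nonneg _)
    _ = d * x := by rw [hcsum, mul_one]

/-! ### Singular values of states of bounded Schmidt number -/

/-- The right vectors are eigenvectors of T†T and the left ones their normalized images, which exist
only for nonzero singular values. -/
theorem exists_singular_vectors {E F : Type*} [NormedAddCommGroup E] [InnerProductSpace ℝ E]
    [FiniteDimensional ℝ E] [NormedAddCommGroup F] [InnerProductSpace ℝ F]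
    [FiniteDimensional ℝ F] (T : E →ₗ[ℝ] F) {n : ℕ} (hn : Module.finrank ℝ E = n) :
    ∃ (u : {i : Fin n // T.singularValues i ≠ 0} → F)
      (v : {i : Fin n // T.singularValues i ≠ 0} → E),
      Orthonormal ℝ u ∧ Orthonormal ℝ v ∧ ∀ j, inner ℝ (u j) (T (v j)) = T.singularValues j.1 := by
  let w := T.isSymmetric_adjoint_comp_self.eigenvectorBasis hn
  have hT : ∀ i j, inner ℝ (T (w i)) (T (w j))
      = if i = j then T.singularValues i ^ 2 else 0 := by
    intro i j
    rw [← LinearMap.adjoint_inner_right, ← LinearMap.comp_apply,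
      T.isSymmetric_adjoint_comp_self.apply_eigenvectorBasis hn j,
      ← T.sq_singularValues_fin hn, inner_smul_right, orthonormal_iff_ite.1 w.orthonormal i j]
    split_ifs with h
    · simp [h]
    · simp
  refine ⟨fun j => (T.singularValues j.1)⁻¹ • T (w j.1), fun j => w j.1, ?_,
    w.orthonormal.comp _ Subtype.val_injective, fun j => ?_⟩
  · rw [orthonormal_iff_ite]
    intro i j
    rw [inner_smul_left, inner_smul_right, hT]
    by_cases h : i = j
    · subst h
      have := i.2
      simp only [if_true, conj_trivial]
      field_simp
    · rw [if_neg h, if_neg fun h' => h (Subtype.ext h')]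
      simp
  · have := j.2
    rw [inner_smul_left, hT, if_pos rfl]
    simp only [conj_trivial]
    field_simp

theorem inner_toEuclideanLin {ι : Type*} [Fintype ι] [DecidableEq ι] (A : Matrix ι ι ℝ)
    (u v : EuclideanSpace ℝ ι) :
    inner ℝ u (Matrix.toEuclideanLin A v) = ∑ a, ∑ b, u a * v b * A a b := by
  rw [PiLp.inner_apply]
  refine Finset.sum_congr rfl fun a _ => ?_
  rw [Matrix.ofLp_toLpLin, Matrix.toLin'_apply, RCLike.inner_apply, conj_trivial, Matrix.mulVec,
    dotProduct, Finset.sum_mul]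
  refine Finset.sum_congr rfl fun b _ => ?_
  ring

theorem corrReal_sum {d N : ℕ} (p : Fin N → ℝ) (σ : Fin N → BipartiteOp d) (a b : RealIdx d) :
    corrReal (∑ m, (p m : ℂ) • σ m) a b = ∑ m, p m * corrReal (σ m) a b := by
  simp only [corrReal, Matrix.of_apply, Finset.sum_mul, Matrix.smul_mul, Matrix.trace_sum,
    Matrix.trace_smul, Complex.re_sum, smul_eq_mul, Complex.re_ofReal_mul]

/-- The singular values of a state of Schmidt number at most `x` satisfy the constraints. -/
theorem tau_mem_feasible {d x : ℕ} (hd : 2 ≤ d) {ρ : BipartiteOp d}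
    (h : HasSchmidtDecomposition ρ x) : tau ρ ∈ feasible d x (Q2 d (tau ρ)) := by
  obtain ⟨N, p, ψ, hp, hp1, hψ, hr, hρ⟩ := h
  have hfin : Module.finrank ℝ (EuclideanSpace ℝ (RealIdx d)) = numReal d := by
    rw [finrank_euclideanSpace, card_realIdx (by omega)]
  obtain ⟨u, v, hu, hv, huv⟩ := exists_singular_vectors
    (Matrix.toEuclideanLin (corrReal ρ)) hfin
  have hval : ∀ j : {i : Fin (numReal d) // (Matrix.toEuclideanLin (corrReal ρ)).singularValues i ≠ 0},
      tau ρ j.1 = ∑ m, p m * ∑ a, ∑ b,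
        u j a * v j b * corrReal (Matrix.vecMulVec (ψ m) (star (ψ m))) a b := by
    intro j
    rw [tau, ← huv j, inner_toEuclideanLin]
    simp only [Finset.mul_sum]
    rw [Finset.sum_comm]
    conv_rhs => rw [Finset.sum_comm]
    rw [Finset.sum_comm]
    refine Finset.sum_congr rfl fun a _ => ?_
    conv_rhs => rw [Finset.sum_comm]
    refine Finset.sum_congr rfl fun b _ => ?_
    conv_lhs => rw [hρ, corrReal_sum, Finset.mul_sum]
    refine Finset.sum_congr rfl fun m _ => ?_
    ring
  have hd1 : (0 : ℝ) ≤ d - 1 := by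
    have : (2 : ℝ) ≤ d := by exact_mod_cast hd
    linarith
  have hnorm : ∀ w : EuclideanSpace ℝ (RealIdx d), ‖w‖ = 1 → ∑ a, w a ^ 2 ≤ 1 := by
    intro w hw
    have := EuclideanSpace.norm_sq_eq w
    simp only [hw, Real.norm_eq_abs, sq_abs] at this
    linarith
  refine ⟨rfl, ?_, fun j => ⟨LinearMap.singularValues_nonneg _ _, ?_⟩⟩
  · have hsum : ∑ j, tau ρ j = ∑ j : {i : Fin (numReal d) //
        (Matrix.toEuclideanLin (corrReal ρ)).singularValues i ≠ 0}, tau ρ j.1 := by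
      rw [← Finset.sum_subtype (Finset.univ.filter fun i : Fin (numReal d) =>
        (Matrix.toEuclideanLin (corrReal ρ)).singularValues i ≠ 0) (by simp) (tau ρ),
        Finset.sum_filter_of_ne]
      exact fun i _ hi => hi
    rw [hsum, Finset.sum_congr rfl fun j _ => hval j, Finset.sum_comm]
    have : ∀ m ∈ Finset.univ, ∑ j, p m * ∑ a, ∑ b,
        u j a * v j b * corrReal (Matrix.vecMulVec (ψ m) (star (ψ m))) a b
          ≤ p m * ((x : ℝ) * d - 1) := by
      intro m _
      rw [← Finset.mul_sum]
      refine mul_le_mul_of_nonneg_left ?_ (hp m)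
      have := one_add_sum_corrReal_pure_le (ψ m) (hψ m) (hr m)
        (isRealBessel_of_orthonormal hu) (isRealBessel_of_orthonormal hv)
      linarith
    refine (Finset.sum_le_sum this).trans (le_of_eq ?_)
    rw [← Finset.sum_mul, hp1, one_mul]
  · by_cases hj : (Matrix.toEuclideanLin (corrReal ρ)).singularValues j = 0
    · rw [tau, hj]
      exact hd1
    · rw [hval ⟨j, hj⟩]
      have : ∀ m ∈ Finset.univ, p m * ∑ a, ∑ b,
          u ⟨j, hj⟩ a * v ⟨j, hj⟩ b * corrReal (Matrix.vecMulVec (ψ m) (star (ψ m))) a b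
            ≤ p m * ((d : ℝ) - 1) := fun m _ =>
        mul_le_mul_of_nonneg_left (corrReal_pure_le (ψ m) (hψ m) _ _ (hnorm _ (hu.1 _))
          (hnorm _ (hv.1 _))) (hp m)
      refine (Finset.sum_le_sum this).trans (le_of_eq ?_)
      rw [← Finset.sum_mul, hp1, one_mul]

/-! ### Schmidt number -/

/-- Every state decomposes into pure states of Schmidt rank at most `d`. -/
theorem hasSchmidtDecomposition_of_isState {d : ℕ} {ρ : BipartiteOp d} (hρ : IsState ρ) :
    HasSchmidtDecomposition ρ d := by
  have hH := hρ.1.isHermitian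
  obtain ⟨U, hU1, -, hU⟩ := exists_unitary_diagonal hH
  let e := (Fintype.equivFin (Fin d × Fin d)).symm
  refine ⟨Fintype.card (Fin d × Fin d), fun j => hH.eigenvalues (e j), fun j i => U i (e j),
    fun j => hρ.1.eigenvalues_nonneg _, ?_, fun j => ?_, fun j => ?_, ?_⟩
  · rw [e.sum_comp fun i => hH.eigenvalues i]
    have := hH.trace_eq_sum_eigenvalues
    rw [hρ.2] at this
    refine Complex.ofReal_injective ?_
    rw [Complex.ofReal_sum, Complex.ofReal_one]
    exact this.symm
  · have := congrFun (congrFun hU1 (e j)) (e j)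
    rw [Matrix.mul_apply, Matrix.one_apply_eq] at this
    refine Complex.ofReal_injective ?_
    rw [Complex.ofReal_one, ← this, Complex.ofReal_sum]
    refine Finset.sum_congr rfl fun i _ => ?_
    rw [Matrix.conjTranspose_apply, RCLike.star_def, Complex.conj_mul']
    push_cast
    rfl
  · exact (Matrix.rank_le_card_height _).trans (Fintype.card_fin d).le
  · rw [e.sum_comp fun i => (hH.eigenvalues i : ℂ) •
      Matrix.vecMulVec (fun k => U k i) (star fun k => U k i)]
    ext k l
    conv_lhs => rw [hU]
    rw [Matrix.mul_apply, Matrix.sum_apply]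
    refine Finset.sum_congr rfl fun i _ => ?_
    rw [Matrix.mul_diagonal, Matrix.smul_apply, Matrix.vecMulVec_apply,
      Matrix.conjTranspose_apply, Pi.star_apply, smul_eq_mul]
    ring

theorem HasSchmidtDecomposition.mono {d r s : ℕ} {ρ : BipartiteOp d}
    (h : HasSchmidtDecomposition ρ r) (hrs : r ≤ s) : HasSchmidtDecomposition ρ s := by
  obtain ⟨N, p, ψ, hp, hp1, hψ, hr, hρ⟩ := h
  exact ⟨N, p, ψ, hp, hp1, hψ, fun j => (hr j).trans hrs, hρ⟩

/-- The infimum is attained because the set contains d; on an empty set `sInf` would be 0. -/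
theorem hasSchmidtDecomposition_schmidtNumber {d : ℕ} {ρ : BipartiteOp d} (hρ : IsState ρ) :
    HasSchmidtDecomposition ρ (schmidtNumber ρ) :=
  Nat.sInf_mem (s := {r | HasSchmidtDecomposition ρ r}) ⟨d, hasSchmidtDecomposition_of_isState hρ⟩

theorem schmidtNumber_le {d : ℕ} {ρ : BipartiteOp d} (hρ : IsState ρ) : schmidtNumber ρ ≤ d :=
  Nat.sInf_le (hasSchmidtDecomposition_of_isState hρ)

end RRM

end

theorem mainTheorem2 (d : ℕ) (hd : 2 ≤ d) :
    -- `F_min(x, y)` is the minimum of the optimization problem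
    (∀ (x : ℕ) (y : ℝ), 1 ≤ x → x ≤ d →
      0 ≤ y → y < ((d : ℝ) * x - 1) ^ 2 / (RRM.numReal d : ℝ) ^ 2 →
      (RRM.feasible d x y).Nonempty →
      IsLeast (RRM.Q4 d '' RRM.feasible d x y) (RRM.Fmin d x y)) ∧
    -- the Schmidt-number criterion
    (∀ (ρ : RRM.BipartiteOp d), RRM.IsState ρ → ∀ (C₂ C₄ : ℝ),
      C₂ = RRM.Q2 d (RRM.tau ρ) → C₄ = RRM.Q4 d (RRM.tau ρ) →
      ∀ r : ℕ, 2 ≤ r → r ≤ d →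
      ((C₂ < ((d : ℝ) * ((r - 1 : ℕ) : ℝ) - 1) ^ 2 / (RRM.numReal d : ℝ) ^ 2 ∧
          C₄ < RRM.Fmin d (r - 1) C₂) ∨
        (∀ τ ∈ RRM.feasible d (r - 1) C₂, C₄ < RRM.Q4 d τ)) →
      r ≤ RRM.schmidtNumber ρ ∧ (r = d → RRM.schmidtNumber ρ = r)) := by
  refine ⟨fun x y hx _ hy hhi hne => RRM.isLeast_Fmin hd hx hy hhi hne, ?_⟩
  rintro ρ hρ C₂ C₄ rfl rfl r hr hrd h
  have hle : r ≤ RRM.schmidtNumber ρ := by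
    by_contra hlt
    -- If the Schmidt number were at most r - 1, τ would itself compete in the problem at level r -
    -- 1.
    have hτ := RRM.tau_mem_feasible hd
      ((RRM.hasSchmidtDecomposition_schmidtNumber hρ).mono (s := r - 1) (by omega))
    rcases h with ⟨h2, h4⟩ | h
    · have hy : 0 ≤ RRM.Q2 d (RRM.tau ρ) :=
        mul_nonneg (by positivity) (Finset.sum_nonneg fun _ _ => sq_nonneg _)
      exact absurd ((RRM.isLeast_Fmin hd (by omega) hy h2 ⟨_, hτ⟩).2 ⟨_, hτ, rfl⟩) (not_le.2 h4)
    · exact lt_irrefl _ (h _ hτ)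
  exact ⟨hle, fun hr' => le_antisymm (hr' ▸ RRM.schmidtNumber_le hρ) hle⟩
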